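/- Let $n,p\ge 1$ be integers and let $\delta,\lambda,\mu,l,\sigma$ be real numbers with $\delta,l\ge 0$, $\lambda\ge\mu\ge 0$ and $0\le\sigma<p$. Let $\mathcal U=\{z\in\mathbb C:|z|<1\}$ and let $\mathcal A(n,p)$ be the class of functions $f(z)=z^p+\sum_{k=n+p}^\infty a_kz^k$ that are analytic and $p$-valent in $\mathcal U$ (counted with multiplicity, $f$ takes no value more than $p$ times in $\mathcal U$, and takes some value exactly $p$ times). For such $f$ put $$\mathcal J_p^\delta(\lambda,\mu,l)f(z)=z^p+\sum_{k=n+p}^\infty\left[\frac{(k-p)(\lambda\mu k+\lambda-\mu)+p+l}{p+l}\right]^\delta a_kz^k .$$ For functions $g,h$ on $\mathcal U$ write $g\prec h$ if there is an analytic $w:\mathcal U\to\mathcal U$ with $w(0)=0$ and $g(z)=h(w(z))$ for all $z\in\mathcal U$. For distinct $A,B\in[-1,1]$ let $\mathcal P^\delta_{\lambda,\mu,l}(A,B;\sigma,p)$ be the set of all $f\in\mathcal A(n,p)$ with $$\frac1{p-\sigma}\left(\frac{[\mathcal J_p^\delta(\lambda,\mu,l)f(z)]'}{z^{p-1}}-\sigma\right)\prec\frac{1+Az}{1+Bz}\qquad(z\in\mathcal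 U),$$ where the quotient is extended analytically to $z=0$. **Theorem 2.2.** If $-1\le A_2\le A_1<B_1\le B_2\le 1$, then $$\mathcal P^{\delta+1}_{\lambda,\mu,l}(B_1,A_1;\sigma,p)\subseteq\mathcal P^{\delta}_{\lambda,\mu,l}(B_2,A_2;\sigma,p).$$ -/

import Mathlib

namespace MultiplierClass

/-- The open unit disk of the complex plane. -/
def unitDisk : Set ℂ := Metric.ball (0 : ℂ) 1

/-- The `k`-th Taylor coefficient of `f` at the origin. -/
noncomputable def taylorCoeff (f : ℂ → ℂ) (k : ℕ) : ℂ :=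
  iteratedDeriv k f 0 / (k.factorial : ℂ)

/-- The number of solutions in the unit disk of `f z = w`, counted with multiplicity
(an element of `ℕ∞`); meant for `f` analytic in the disk. -/
noncomputable def valueCount (f : ℂ → ℂ) (w : ℂ) : ℕ∞ :=
  ∑' z : unitDisk, analyticOrderAt (fun ζ : ℂ => f ζ - w) (z : ℂ)

/-- `f` is `p`-valent in the unit disk: with multiplicity, it takes no value more than `p` times,
and it takes some value exactly `p` times. -/
def IsPValent (p : ℕ) (f : ℂ → ℂ) : Prop :=
  (∀ w : ℂ, valueCount f w ≤ (p : ℕ∞)) ∧ ∃ w : ℂ, valueCount f w = (p : ℕ∞)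

/-- The class `𝒜(n, p)` of functions `f(z) = z ^ p + ∑_{k ≥ n + p} a_k z ^ k` that are analytic
and `p`-valent in the unit disk. Only the values of `f` in the disk matter. -/
structure IsNormalized (n p : ℕ) (f : ℂ → ℂ) : Prop where
  analytic : AnalyticOnNhd ℂ f unitDisk
  expansion : ∀ z ∈ unitDisk,
    HasSum (fun j : ℕ => taylorCoeff f (n + p + j) * z ^ (n + p + j)) (f z - z ^ p)
  pvalent : IsPValent p f

/-- The multiplier `[((k - p)(λ μ k + λ - μ) + p + l) / (p + l)] ^ δ` (a real power). -/
noncomputable def multiplier (p k : ℕ) (δ lam μ l : ℝ) : ℝ :=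
  ((((k : ℝ) - (p : ℝ)) * (lam * μ * (k : ℝ) + lam - μ) + (p : ℝ) + l) / ((p : ℝ) + l)) ^ δ

/-- The multiplier transformation on `𝒜(n, p)`: it sends `f(z) = z ^ p + ∑_{k ≥ n + p} a_k z ^ k`
to `z ^ p + ∑_{k ≥ n + p} (multiplier p k δ λ μ l) a_k z ^ k`. -/
noncomputable def multiplierTransform (n p : ℕ) (δ lam μ l : ℝ) (f : ℂ → ℂ) (z : ℂ) : ℂ :=
  z ^ p + ∑' j : ℕ, (multiplier p (n + p + j) δ lam μ l : ℂ) *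
    taylorCoeff f (n + p + j) * z ^ (n + p + j)

/-- Subordination `f ≺ g` in the unit disk: `f = g ∘ w` for some Schwarz function `w`. -/
def Subordinate (f g : ℂ → ℂ) : Prop :=
  ∃ w : ℂ → ℂ, AnalyticOnNhd ℂ w unitDisk ∧ w 0 = 0 ∧ (∀ z ∈ unitDisk, ‖w z‖ < 1) ∧
    ∀ z ∈ unitDisk, f z = g (w z)

/-- The class `𝒫^δ_{λ,μ,l}(A, B; σ, p)` inside `𝒜(n, p)`: with `J` the transform of `f`,
`(1 / (p - σ)) (J' / z ^ (p - 1) - σ) ≺ (1 + A z) / (1 + B z)` in the unit disk.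
The first slot `A` belongs to the numerator, the second slot `B` to the denominator.
The quotient `J' / z ^ (p - 1)` has a removable singularity at the origin when `p ≥ 2`; it is
the (unique) analytic function `F` in the disk with `J' = z ^ (p - 1) F`. -/
def classP (n p : ℕ) (δ lam μ l A B σ : ℝ) : Set (ℂ → ℂ) :=
  {f | IsNormalized n p f ∧
    ∃ F : ℂ → ℂ, AnalyticOnNhd ℂ F unitDisk ∧
      (∀ z ∈ unitDisk,
        deriv (multiplierTransform n p δ lam μ l f) z = z ^ (p - 1) * F z) ∧
      Subordinate (fun z => 1 / ((p : ℂ) - (σ : ℂ)) * (F z - (σ : ℂ)))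
        (fun z => (1 + (A : ℂ) * z) / (1 + (B : ℂ) * z))}

end MultiplierClass

open Filter Topology Asymptotics

namespace MultiplierClass

/-! Write `θ = z d/dz`. With `k = p + i` the base of the multiplier is `1 + a i + b i ^ 2`, where
`a, b ≥ 0`. Raising `δ` by one therefore acts on `G = (J f)' / z ^ (p - 1)` as the operator `1 + a θ
+ b θ²` (`powerSum_derivCoeff_add_one`). Where `Re (η G)` is maximal on a closed disk about `0`, `Re
(η θG)` and `Re (η θ²G)` are nonnegative (`re_nonneg_of_isMaxOn`), so an open half-plane containing
the values of `G + a θG + b θ²G` also contains those of `G`. The image of the disk under `(1 + B z)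
/ (1 + A z)` is a disk or a half-plane, hence is inherited as well (`norm_sub_one_lt_of_euler`).
These regions are nested in the parameters (`norm_sub_one_lt_mono`), and lying in them is equivalent
to subordination for analytic functions with value `1` at `0`. -/

theorem isOpen_unitDisk : IsOpen unitDisk := Metric.isOpen_ball

theorem mem_unitDisk {z : ℂ} : z ∈ unitDisk ↔ ‖z‖ < 1 := mem_ball_zero_iff

/-! ### Power series in the disk and the operator `z d/dz` -/

/-- The power series with coefficients `e` converges absolutely in the unit disk. -/
def DiskSummable (e : ℕ → ℂ) : Prop :=
  ∀ r : ℝ, 0 < r → r < 1 → Summable fun i => ‖e i‖ * r ^ i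

/-- The sum of the power series with coefficients `e`. -/
noncomputable def powerSum (e : ℕ → ℂ) (z : ℂ) : ℂ := ∑' i, e i * z ^ i

theorem DiskSummable.mul_of_le_pow {e w : ℕ → ℂ} (he : DiskSummable e) {C : ℝ} {N : ℕ}
    (hw : ∀ i, 1 ≤ i → ‖w i‖ ≤ C * (i : ℝ) ^ N) : DiskSummable fun i => w i * e i := by
  intro r hr hr1
  obtain ⟨s, hrs, hs1⟩ := exists_between hr1
  have hs : 0 < s := hr.trans hrs
  -- Terms are bounded at the larger radius `s`; the geometric factor `(r / s) ^ i` then absorbs the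
  -- polynomial weight.
  obtain ⟨K, hK⟩ := (he s hs hs1).tendsto_atTop_zero.bddAbove_range
  have hK' : ∀ i, ‖e i‖ * s ^ i ≤ K := fun i => hK ⟨i, rfl⟩
  have hq : ‖r / s‖ < 1 := by
    rw [Real.norm_of_nonneg (by positivity), div_lt_one hs]
    exact hrs
  refine summable_of_isBigO_nat (summable_pow_mul_geometric_of_norm_lt_one N hq) ?_
  refine IsBigO.of_bound (C * K) ?_
  filter_upwards [eventually_ge_atTop 1] with i hi
  have h1 := hw i hi
  have h2 := hK' i
  rw [Real.norm_of_nonneg (by positivity), Real.norm_of_nonneg (by positivity), norm_mul]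
  calc ‖w i‖ * ‖e i‖ * r ^ i = ‖w i‖ * (‖e i‖ * s ^ i) * (r / s) ^ i := by
        rw [div_pow]; field_simp
    _ ≤ (C * (i : ℝ) ^ N) * K * (r / s) ^ i := by
        gcongr
        exact (norm_nonneg _).trans h1
    _ = C * K * ((i : ℝ) ^ N * (r / s) ^ i) := by ring

theorem DiskSummable.natCast_mul {e : ℕ → ℂ} (he : DiskSummable e) :
    DiskSummable fun i => (i : ℂ) * e i :=
  he.mul_of_le_pow (C := 1) (N := 1) fun i _ => by simp

theorem DiskSummable.summable {e : ℕ → ℂ} (he : DiskSummable e) {z : ℂ} (hz : z ∈ unitDisk) :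
    Summable fun i => e i * z ^ i := by
  obtain ⟨r, hzr, hr1⟩ := exists_between (mem_unitDisk.1 hz)
  refine Summable.of_norm_bounded (he r ((norm_nonneg z).trans_lt hzr) hr1) fun i => ?_
  rw [norm_mul, norm_pow]
  gcongr

/-- Termwise differentiation; the factor `z` avoids an index shift, so `z d/dz` is diagonal on
coefficients. -/
theorem DiskSummable.differentiableAt_and_mul_deriv {e : ℕ → ℂ} (he : DiskSummable e) {z : ℂ}
    (hz : z ∈ unitDisk) :
    DifferentiableAt ℂ (powerSum e) z ∧
      z * deriv (powerSum e) z = powerSum (fun i => (i : ℂ) * e i) z := by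
  obtain ⟨r, hzr, hr1⟩ := exists_between (mem_unitDisk.1 hz)
  have hzr' : z ∈ Metric.ball (0 : ℂ) r := mem_ball_zero_iff.2 hzr
  have hu := he r ((norm_nonneg z).trans_lt hzr) hr1
  have hF : ∀ i, DifferentiableOn ℂ (fun z : ℂ => e i * z ^ i) (Metric.ball 0 r) := fun i => by
    fun_prop
  have hle : ∀ i, ∀ w ∈ Metric.ball (0 : ℂ) r, ‖e i * w ^ i‖ ≤ ‖e i‖ * r ^ i := fun i w hw => by
    rw [norm_mul, norm_pow]
    have := (mem_ball_zero_iff.1 hw).le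
    gcongr
  constructor
  · exact (Complex.differentiableOn_tsum_of_summable_norm hu hF Metric.isOpen_ball
      hle).differentiableAt (Metric.isOpen_ball.mem_nhds hzr')
  · have h := (Complex.hasSum_deriv_of_summable_norm hu hF Metric.isOpen_ball hle hzr').mul_left z
    refine h.tsum_eq.symm.trans (tsum_congr fun i => ?_)
    rcases i with _ | i
    · simp
    · rw [deriv_const_mul_field, deriv_pow_field, Nat.add_sub_cancel, pow_succ]
      ring

theorem DiskSummable.differentiableOn {e : ℕ → ℂ} (he : DiskSummable e) :
    DifferentiableOn ℂ (powerSum e) unitDisk := fun _ hz =>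
  (he.differentiableAt_and_mul_deriv hz).1.differentiableWithinAt

theorem DiskSummable.mul_deriv {e : ℕ → ℂ} (he : DiskSummable e) {z : ℂ} (hz : z ∈ unitDisk) :
    z * deriv (powerSum e) z = powerSum (fun i => (i : ℂ) * e i) z :=
  (he.differentiableAt_and_mul_deriv hz).2

theorem powerSum_zero (e : ℕ → ℂ) : powerSum e 0 = e 0 := by
  rw [powerSum, tsum_eq_single 0 fun i hi => by simp [hi]]
  simp

/-! ### Maximum principle for the Euler-type equation -/

/-- A real function with a local maximum has nonpositive second derivative there. -/
theorem second_deriv_nonpos_of_isLocalMax {u u' : ℝ → ℝ} {u'' x : ℝ} (hmax : IsLocalMax u x)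
    (hu : ∀ t, HasDerivAt u (u' t) t) (hu' : HasDerivAt u' u'' x) : u'' ≤ 0 := by
  by_contra! hpos
  have hd : deriv u = u' := funext fun t => (hu t).deriv
  have hmin : IsLocalMin u x := isLocalMin_of_deriv_deriv_pos (by rwa [hd, hu'.deriv])
    hmax.deriv_eq_zero (hu x).continuousAt
  -- A point that is both a local maximum and a local minimum makes `u` locally constant, forcing
  -- `u'' = 0`.
  have hc : u =ᶠ[𝓝 x] fun _ => u x := by
    filter_upwards [hmax, hmin] with t h1 h2 using le_antisymm h1 h2
  have h2 := hc.deriv.deriv_eq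
  rw [hd, hu'.deriv] at h2
  simp at h2
  exact hpos.ne' h2

/-- At a point where the real part of `G` is maximal on a closed disk about the origin, the real
parts of `z G'` and `z (z G')'` are nonnegative. -/
theorem re_nonneg_of_isMaxOn {G G₁ G₂ : ℂ → ℂ} {r : ℝ} (hr : r < 1)
    (hG : DifferentiableOn ℂ G unitDisk) (hG₁ : DifferentiableOn ℂ G₁ unitDisk)
    (h₁ : ∀ z ∈ unitDisk, z * deriv G z = G₁ z) (h₂ : ∀ z ∈ unitDisk, z * deriv G₁ z = G₂ z)
    {z : ℂ} (hz : z ∈ Metric.closedBall (0 : ℂ) r)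
    (hmax : IsMaxOn (fun w => (G w).re) (Metric.closedBall 0 r) z) :
    0 ≤ (G₁ z).re ∧ 0 ≤ (G₂ z).re := by
  have hzr : ‖z‖ ≤ r := mem_closedBall_zero_iff.1 hz
  -- Along `t ↦ exp (t c) z`, `d/dt` acts as `c θ`; `c = 1` gives the radial direction and `c = I`
  -- the rotation.
  have key : ∀ {K K₁ : ℂ → ℂ}, DifferentiableOn ℂ K unitDisk →
      (∀ z ∈ unitDisk, z * deriv K z = K₁ z) → ∀ (c : ℂ) (t : ℝ),
      Complex.exp (t * c) * z ∈ unitDisk →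
      HasDerivAt (fun s : ℝ => K (Complex.exp (s * c) * z))
        (c * K₁ (Complex.exp (t * c) * z)) t := by
    intro K K₁ hK hK₁ c t hm
    have e1 : HasDerivAt (fun s : ℝ => Complex.exp (s * c) * z)
        (Complex.exp (t * c) * c * z) t := by
      have := (((hasDerivAt_id (t : ℂ)).mul_const c).cexp.mul_const z).comp_ofReal
      simpa using this
    have e2 := (hK.differentiableAt (isOpen_unitDisk.mem_nhds hm)).hasDerivAt.comp t e1
    rw [← hK₁ _ hm]
    exact e2.congr_deriv (by ring)
  have hre : ∀ {k : ℝ → ℂ} {k' : ℂ} {t : ℝ}, HasDerivAt k k' t →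
      HasDerivAt (fun s => (k s).re) k'.re t := fun {k k' t} h =>
    (Complex.reCLM.hasFDerivAt.comp_hasDerivAt t h)
  have hrot : ∀ t : ℝ, ‖Complex.exp (t * Complex.I) * z‖ = ‖z‖ := fun t => by
    rw [norm_mul, Complex.norm_exp_ofReal_mul_I, one_mul]
  have hrotm : ∀ t : ℝ, Complex.exp (t * Complex.I) * z ∈ unitDisk := fun t =>
    mem_unitDisk.2 ((hrot t).trans_lt (hzr.trans_lt hr))
  constructor
  · have h := hre (key hG h₁ 1 0 (by simpa using mem_unitDisk.2 (hzr.trans_lt hr)))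
    simp only [Complex.ofReal_zero, Complex.exp_zero, one_mul, mul_one] at h
    -- Only `t < 0` is sure to stay in the closed disk, so the left derivative is used.
    refine ge_of_tendsto ((hasDerivWithinAt_iff_tendsto_slope' Set.self_notMem_Iio).1
      (h.hasDerivWithinAt (s := Set.Iio 0))) ?_
    filter_upwards [self_mem_nhdsWithin] with t ht
    have ht0 : t < 0 := ht
    have hb : Complex.exp t * z ∈ Metric.closedBall (0 : ℂ) r := by
      rw [mem_closedBall_zero_iff, norm_mul, Complex.norm_exp, Complex.ofReal_re]
      exact (mul_le_of_le_one_left (norm_nonneg _) (Real.exp_le_one_iff.2 ht0.le)).trans hzr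
    have := hmax hb
    simp only [Set.mem_ofPred_eq] at this
    rw [slope_def_field]
    refine div_nonneg_of_nonpos ?_ (by linarith)
    simpa using this
  · have hd := fun t => hre (key hG h₁ Complex.I t (hrotm t))
    have hd' := hre ((key hG₁ h₂ Complex.I 0 (hrotm 0)).const_mul Complex.I)
    -- Rotation preserves the disk, and the second derivative along it is `I * I * G₂ = -G₂`.
    have hm : IsLocalMax (fun s : ℝ => (G (Complex.exp (s * Complex.I) * z)).re) 0 := by
      refine Eventually.of_forall fun t => ?_
      have := hmax (mem_closedBall_zero_iff.2 ((hrot t).trans_le hzr))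
      simpa using this
    have := second_deriv_nonpos_of_isLocalMax hm hd hd'
    simp only [← mul_assoc, Complex.I_mul_I] at this
    simpa using this

/-- Half-planes are inherited by solutions of the Euler-type equation
`G + a z G' + b z (z G')' = H` with `a, b ≥ 0`. -/
theorem re_lt_of_euler {G G₁ G₂ : ℂ → ℂ} {a b M : ℝ} (ha : 0 ≤ a) (hb : 0 ≤ b)
    (hG : DifferentiableOn ℂ G unitDisk) (hG₁ : DifferentiableOn ℂ G₁ unitDisk)
    (h₁ : ∀ z ∈ unitDisk, z * deriv G z = G₁ z) (h₂ : ∀ z ∈ unitDisk, z * deriv G₁ z = G₂ z)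
    (hM : ∀ z ∈ unitDisk, (G z + a * G₁ z + b * G₂ z).re < M) :
    ∀ z ∈ unitDisk, (G z).re < M := by
  intro z hz
  have hz1 := mem_unitDisk.1 hz
  have hsub : Metric.closedBall (0 : ℂ) ‖z‖ ⊆ unitDisk := Metric.closedBall_subset_ball hz1
  obtain ⟨x, hx, hmax⟩ := (isCompact_closedBall (0 : ℂ) ‖z‖).exists_isMaxOn
    ⟨z, mem_closedBall_zero_iff.2 le_rfl⟩
    (Complex.continuous_re.comp_continuousOn (hG.continuousOn.mono hsub))
  obtain ⟨n1, n2⟩ := re_nonneg_of_isMaxOn hz1 hG hG₁ h₁ h₂ hx hmax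
  have hzx : (G z).re ≤ (G x).re := hmax (mem_closedBall_zero_iff.2 le_rfl)
  have hx' := hM x (hsub hx)
  simp only [Complex.add_re, Complex.re_ofReal_mul] at hx'
  have := mul_nonneg ha n1
  have := mul_nonneg hb n2
  linarith

/-- The affine version of `re_lt_of_euler`. -/
theorem re_mul_sub_lt_of_euler {G G₁ G₂ : ℂ → ℂ} {a b M : ℝ} (ha : 0 ≤ a) (hb : 0 ≤ b)
    (hG : DifferentiableOn ℂ G unitDisk) (hG₁ : DifferentiableOn ℂ G₁ unitDisk)
    (h₁ : ∀ z ∈ unitDisk, z * deriv G z = G₁ z) (h₂ : ∀ z ∈ unitDisk, z * deriv G₁ z = G₂ z)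
    (η : ℂ)
    (hM : ∀ z ∈ unitDisk, (η * (G z + a * G₁ z + b * G₂ z)).re < M) :
    ∀ z ∈ unitDisk, (η * G z).re < M := by
  have hdiff : ∀ {K : ℂ → ℂ}, DifferentiableOn ℂ K unitDisk → ∀ z ∈ unitDisk,
      deriv (fun w => η * K w) z = η * deriv K z := fun hK z hz =>
    deriv_const_mul _ (hK.differentiableAt (isOpen_unitDisk.mem_nhds hz))
  refine re_lt_of_euler (G := fun z => η * G z) (G₁ := fun z => η * G₁ z)
    (G₂ := fun z => η * G₂ z) ha hb (hG.const_mul η) (hG₁.const_mul η) ?_ ?_ ?_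
  · intro z hz
    rw [hdiff hG z hz, ← h₁ z hz]
    ring
  · intro z hz
    rw [hdiff hG₁ z hz, ← h₂ z hz]
    ring
  · intro z hz
    convert hM z hz using 2
    ring


/-! ### Image regions of the Möbius maps -/

theorem one_add_mul_ne_zero {A : ℝ} (hA : |A| ≤ 1) {w : ℂ} (hw : ‖w‖ < 1) :
    1 + (A : ℂ) * w ≠ 0 := by
  intro h
  have h1 : (A : ℂ) * w = -1 := by linear_combination h
  have h2 : |A| * ‖w‖ = 1 := by
    rw [← Real.norm_eq_abs, ← Complex.norm_real, ← norm_mul, h1, norm_neg, norm_one]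
  nlinarith [norm_nonneg w, abs_nonneg A]

/-- Subordination to `(1 + B z) / (1 + A z)` means that the values lie in the image region. -/
theorem norm_sub_one_lt_of_subordinate {F : ℂ → ℂ} {A B : ℝ} (hA : -1 ≤ A) (hAB : A < B)
    (hB : B ≤ 1) (h : Subordinate F fun z => (1 + (B : ℂ) * z) / (1 + (A : ℂ) * z)) :
    ∀ z ∈ unitDisk, ‖F z - 1‖ < ‖(B : ℂ) - A * F z‖ := by
  obtain ⟨w, -, -, hw1, hw⟩ := h
  intro z hz
  have hne := one_add_mul_ne_zero (abs_le.2 ⟨hA, hAB.le.trans hB⟩) (hw1 z hz)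
  have e1 : F z - 1 = w z * (((B : ℂ) - A) / (1 + A * w z)) := by
    rw [hw z hz, ← mul_div_assoc, eq_div_iff hne, sub_mul, div_mul_cancel₀ _ hne]
    ring
  have e2 : (B : ℂ) - A * F z = ((B : ℂ) - A) / (1 + A * w z) := by
    rw [hw z hz, eq_div_iff hne, sub_mul, mul_assoc, div_mul_cancel₀ _ hne]
    ring
  rw [e1, e2, norm_mul]
  refine mul_lt_of_lt_one_left (norm_pos_iff.2 (div_ne_zero ?_ hne)) (hw1 z hz)
  exact_mod_cast (sub_pos.2 hAB).ne'

/-- An analytic function with values in the image region of `(1 + B z) / (1 + A z)` and value `1`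
at the origin is subordinate to it. -/
theorem subordinate_of_norm_sub_one_lt {F : ℂ → ℂ} {A B : ℝ} (hAB : A < B)
    (hF : AnalyticOnNhd ℂ F unitDisk) (hF0 : F 0 = 1)
    (h : ∀ z ∈ unitDisk, ‖F z - 1‖ < ‖(B : ℂ) - A * F z‖) :
    Subordinate F fun z => (1 + (B : ℂ) * z) / (1 + (A : ℂ) * z) := by
  have hne : ∀ z ∈ unitDisk, (B : ℂ) - A * F z ≠ 0 := fun z hz =>
    norm_pos_iff.1 ((norm_nonneg _).trans_lt (h z hz))
  refine ⟨fun z => (F z - 1) / ((B : ℂ) - A * F z), ?_, by simp [hF0], ?_, ?_⟩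
  · exact (hF.sub analyticOnNhd_const).div
      (analyticOnNhd_const.sub (analyticOnNhd_const.mul hF)) hne
  · intro z hz
    rw [norm_div, div_lt_one (norm_pos_iff.2 (hne z hz))]
    exact h z hz
  · intro z hz
    have h1 := hne z hz
    have h2 : (B : ℂ) - A ≠ 0 := by exact_mod_cast (sub_pos.2 hAB).ne'
    have e1 : 1 + (B : ℂ) * ((F z - 1) / ((B : ℂ) - A * F z)) =
        ((B : ℂ) - A) * F z / ((B : ℂ) - A * F z) := by
      rw [eq_div_iff h1, add_mul, mul_assoc, div_mul_cancel₀ _ h1]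
      ring
    have e2 : 1 + (A : ℂ) * ((F z - 1) / ((B : ℂ) - A * F z)) =
        ((B : ℂ) - A) / ((B : ℂ) - A * F z) := by
      rw [eq_div_iff h1, add_mul, mul_assoc, div_mul_cancel₀ _ h1]
      ring
    simp only [e1, e2]
    rw [div_div_div_cancel_right₀ h1, mul_div_cancel_left₀ _ h2]

/-- The image regions of `(1 + B z) / (1 + A z)` grow with `B` and shrink with `A`. -/
theorem norm_sub_one_lt_mono {A₁ A₂ B₁ B₂ : ℝ} (hA₂ : -1 ≤ A₂) (hA : A₂ ≤ A₁) (hAB : A₁ < B₁)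
    (hB : B₁ ≤ B₂) (hB₂ : B₂ ≤ 1) {x : ℂ} (h : ‖x - 1‖ < ‖(B₁ : ℂ) - A₁ * x‖) :
    ‖x - 1‖ < ‖(B₂ : ℂ) - A₂ * x‖ := by
  have hd : 0 < B₁ - A₁ := sub_pos.2 hAB
  -- The reverse triangle inequality applied to this identity reduces the claim to the parameter
  -- inequality `hk`.
  have key : (B₁ - A₁ : ℂ) * ((B₂ : ℂ) - A₂ * x) =
      (B₂ - A₂ : ℂ) * ((B₁ : ℂ) - A₁ * x) + (A₁ * B₂ - A₂ * B₁ : ℂ) * (x - 1) := by ring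
  have hcast : ∀ s t : ℝ, 0 ≤ s - t → ‖(s : ℂ) - t‖ = s - t := fun s t hst => by
    rw [← Complex.ofReal_sub, Complex.norm_real, Real.norm_of_nonneg hst]
  have n1 : ‖(B₁ : ℂ) - A₁‖ = B₁ - A₁ := hcast _ _ hd.le
  have n2 : ‖(B₂ : ℂ) - A₂‖ = B₂ - A₂ := hcast _ _ (by linarith)
  have n3 : ‖(A₁ * B₂ - A₂ * B₁ : ℂ)‖ = |A₁ * B₂ - A₂ * B₁| := by
    rw [← Real.norm_eq_abs, ← Complex.norm_real]; push_cast; rfl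
  have hk : |A₁ * B₂ - A₂ * B₁| ≤ (B₂ - A₂) - (B₁ - A₁) := by
    rw [abs_le]
    constructor
    · nlinarith [mul_nonneg (sub_nonneg.2 hA) (by linarith : 0 ≤ 1 + B₁),
        mul_nonneg (sub_nonneg.2 hB) (by linarith : 0 ≤ 1 + A₁)]
    · nlinarith [mul_nonneg (sub_nonneg.2 hA) (by linarith : 0 ≤ 1 - B₁),
        mul_nonneg (sub_nonneg.2 hB) (by linarith : 0 ≤ 1 - A₁)]
  have hlow := norm_sub_norm_le ((B₂ - A₂ : ℂ) * ((B₁ : ℂ) - A₁ * x))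
    (-((A₁ * B₂ - A₂ * B₁ : ℂ) * (x - 1)))
  rw [sub_neg_eq_add, ← key, norm_neg, norm_mul, norm_mul, norm_mul, n1, n2, n3] at hlow
  have h3 := mul_le_mul_of_nonneg_right hk (norm_nonneg (x - 1))
  have h4 := mul_lt_mul_of_pos_left h (by linarith : 0 < B₂ - A₂)
  refine lt_of_mul_lt_mul_left ?_ hd.le
  linarith

/-- The image region of `(1 + B z) / (1 + A z)` is inherited by solutions of the Euler-type equation
`G + a z G' + b z (z G')' = H` with `a, b ≥ 0`. -/
theorem norm_sub_one_lt_of_euler {G G₁ G₂ : ℂ → ℂ} {a b A B : ℝ} (ha : 0 ≤ a) (hb : 0 ≤ b)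
    (hA : -1 ≤ A) (hAB : A < B) (hB : B ≤ 1)
    (hG : DifferentiableOn ℂ G unitDisk) (hG₁ : DifferentiableOn ℂ G₁ unitDisk)
    (h₁ : ∀ z ∈ unitDisk, z * deriv G z = G₁ z) (h₂ : ∀ z ∈ unitDisk, z * deriv G₁ z = G₂ z)
    (hH : ∀ z ∈ unitDisk, ‖G z + a * G₁ z + b * G₂ z - 1‖ <
      ‖(B : ℂ) - A * (G z + a * G₁ z + b * G₂ z)‖) :
    ∀ z ∈ unitDisk, ‖G z - 1‖ < ‖(B : ℂ) - A * G z‖ := by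
  have hexp : ∀ x : ℂ, ‖x - 1‖ < ‖(B : ℂ) - A * x‖ ↔
      (1 - A ^ 2) * (x.re ^ 2 + x.im ^ 2) - 2 * x.re * (1 - A * B) + 1 - B ^ 2 < 0 := fun x => by
    rw [← sq_lt_sq₀ (norm_nonneg _) (norm_nonneg _), Complex.sq_norm, Complex.sq_norm,
      Complex.normSq_apply, Complex.normSq_apply]
    simp
    constructor <;> intro h <;> nlinarith
  simp only [hexp] at hH ⊢
  -- For `A = -1` the region is the half-plane `Re x > (1 - B) / 2`; otherwise it is the disk with
  -- centre `c` and radius `ρ`.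
  rcases hA.eq_or_lt with rfl | hA
  · intro z hz
    have h := re_mul_sub_lt_of_euler (M := -(1 - B) / 2) ha hb hG hG₁ h₁ h₂ (-1)
      (fun y hy => by
        have h := hH y hy
        rw [neg_one_mul, Complex.neg_re]
        nlinarith) z hz
    rw [neg_one_mul, Complex.neg_re] at h
    nlinarith
  · have hq : 0 < 1 - A ^ 2 := by nlinarith
    set c : ℝ := (1 - A * B) / (1 - A ^ 2) with hc
    set ρ : ℝ := (B - A) / (1 - A ^ 2) with hρ
    have hρ0 : 0 < ρ := div_pos (sub_pos.2 hAB) hq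
    have hc' : (1 - A ^ 2) * c = 1 - A * B := by rw [hc]; field_simp
    have hρ' : (1 - A ^ 2) * (c ^ 2 - ρ ^ 2) = 1 - B ^ 2 := by
      rw [hc, hρ]; field_simp; ring
    have hdisk : ∀ x : ℂ, (1 - A ^ 2) * (x.re ^ 2 + x.im ^ 2) - 2 * x.re * (1 - A * B) + 1 - B ^ 2
        < 0 ↔ ‖x - c‖ < ρ := fun x => by
      rw [← sq_lt_sq₀ (norm_nonneg _) hρ0.le, Complex.sq_norm, Complex.normSq_apply]
      have e : (1 - A ^ 2) * (x.re ^ 2 + x.im ^ 2) - 2 * x.re * (1 - A * B) + 1 - B ^ 2 =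
          (1 - A ^ 2) * (((x - c).re * (x - c).re + (x - c).im * (x - c).im) - ρ ^ 2) := by
        simp
        linear_combination (-2 * x.re) * (-hc') - hρ'
      rw [e, mul_neg_iff]
      constructor
      · rintro (h | h) <;> linarith [h.1, h.2]
      · intro h
        exact Or.inl ⟨hq, by linarith⟩
    simp only [hdisk] at hH ⊢
    intro z hz
    by_cases h0 : G z - c = 0
    · simpa [h0] using hρ0
    have hn : (‖G z - c‖ : ℂ) ≠ 0 := by simpa using h0
    -- This unimodular `η` turns `G z - c` into its modulus, so the half-plane tangent to the disk
    -- in that direction suffices.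
    set η : ℂ := starRingEnd ℂ (G z - c) / ‖G z - c‖ with hη
    have hη1 : ‖η‖ = 1 := by
      rw [hη, norm_div, RCLike.norm_conj, Complex.norm_real, norm_norm,
        div_self (norm_ne_zero_iff.2 h0)]
    have h := re_mul_sub_lt_of_euler (M := ρ + (η * c).re) ha hb hG hG₁ h₁ h₂ η
      (fun y hy => by
        have h := (Complex.re_le_norm _).trans_lt
          ((norm_mul η (G y + a * G₁ y + b * G₂ y - c)).trans_lt (by
            rw [hη1, one_mul]; exact hH y hy))
        rw [mul_sub, Complex.sub_re] at h
        linarith) z hz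
    have e : η * (G z - c) = (‖G z - c‖ : ℂ) := by
      rw [hη, div_mul_eq_mul_div, Complex.conj_mul', sq, mul_div_assoc, div_self hn, mul_one]
    have e' := congrArg Complex.re e
    rw [mul_sub, Complex.sub_re, Complex.ofReal_re] at e'
    linarith


/-! ### Coefficients of the multiplier transform -/

/-- The coefficients of `f z / z ^ p` for `f z = z ^ p + ∑_{k ≥ n + p} a_k z ^ k`. -/
noncomputable def baseCoeff (n p : ℕ) (f : ℂ → ℂ) (i : ℕ) : ℂ :=
  if i = 0 then 1 else if i < n then 0 else taylorCoeff f (p + i)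

/-- The coefficients of `J f z / z ^ p` for the multiplier transform `J f`. -/
noncomputable def transformCoeff (n p : ℕ) (δ lam μ l : ℝ) (f : ℂ → ℂ) (i : ℕ) : ℂ :=
  (multiplier p (p + i) δ lam μ l : ℂ) * baseCoeff n p f i

/-- The first-order coefficient of the multiplier as a polynomial in `k - p`. -/
noncomputable def linearCoeff (p : ℕ) (lam μ l : ℝ) : ℝ := (lam * μ * p + lam - μ) / (p + l)

/-- The second-order coefficient of the multiplier as a polynomial in `k - p`. -/
noncomputable def quadCoeff (p : ℕ) (lam μ l : ℝ) : ℝ := lam * μ / (p + l)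

theorem multiplier_eq {p : ℕ} (hp : 1 ≤ p) {l : ℝ} (hl : 0 ≤ l) (δ lam μ : ℝ) (i : ℕ) :
    multiplier p (p + i) δ lam μ l =
      (1 + linearCoeff p lam μ l * i + quadCoeff p lam μ l * (i : ℝ) ^ 2) ^ δ := by
  have hp' : (1 : ℝ) ≤ p := by exact_mod_cast hp
  have : (p : ℝ) + l ≠ 0 := by positivity
  rw [multiplier, linearCoeff, quadCoeff]
  congr 1
  push_cast
  field_simp
  ring

section

variable {n p : ℕ} {δ lam μ l : ℝ} {f : ℂ → ℂ}

theorem linearCoeff_nonneg (hμ : 0 ≤ μ) (hlam : μ ≤ lam) (hl : 0 ≤ l) :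
    0 ≤ linearCoeff p lam μ l := by
  have : 0 ≤ lam * μ * p := by have := hμ.trans hlam; positivity
  exact div_nonneg (by linarith) (by positivity)

theorem quadCoeff_nonneg (hμ : 0 ≤ μ) (hlam : μ ≤ lam) (hl : 0 ≤ l) :
    0 ≤ quadCoeff p lam μ l := by
  have := hμ.trans hlam
  unfold quadCoeff
  positivity

theorem transformCoeff_zero (hp : 1 ≤ p) (hl : 0 ≤ l) :
    transformCoeff n p δ lam μ l f 0 = 1 := by
  rw [transformCoeff, multiplier_eq hp hl]
  simp [baseCoeff]

theorem transformCoeff_add_one (hp : 1 ≤ p) (hl : 0 ≤ l) (hμ : 0 ≤ μ) (hlam : μ ≤ lam) (i : ℕ) :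
    transformCoeff n p (δ + 1) lam μ l f i =
      (1 + linearCoeff p lam μ l * i + quadCoeff p lam μ l * (i : ℂ) ^ 2) *
        transformCoeff n p δ lam μ l f i := by
  have ha := linearCoeff_nonneg (p := p) hμ hlam hl
  have hb := quadCoeff_nonneg (p := p) hμ hlam hl
  rw [transformCoeff, transformCoeff, multiplier_eq hp hl, multiplier_eq hp hl,
    Real.rpow_add_one (by positivity)]
  push_cast
  ring

theorem baseCoeff_diskSummable (hn : 1 ≤ n) (hf : IsNormalized n p f) :
    DiskSummable (baseCoeff n p f) := by
  intro r hr hr1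
  have h := (hf.expansion (r : ℂ) (mem_unitDisk.2 (by
    rwa [Complex.norm_real, Real.norm_of_nonneg hr.le]))).summable.norm.mul_right ((r ^ p)⁻¹)
  rw [← summable_nat_add_iff n]
  refine h.congr fun j => ?_
  have e : baseCoeff n p f (j + n) = taylorCoeff f (n + p + j) := by
    rw [baseCoeff, if_neg (by omega), if_neg (by omega)]
    congr 1
    omega
  rw [e, norm_mul, norm_pow, Complex.norm_real, Real.norm_of_nonneg hr.le]
  have : r ^ (n + p + j) = r ^ (j + n) * r ^ p := by rw [← pow_add]; congr 1; omega
  rw [this]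
  field_simp

theorem transformCoeff_diskSummable (hn : 1 ≤ n) (hp : 1 ≤ p) (hl : 0 ≤ l) (hμ : 0 ≤ μ)
    (hlam : μ ≤ lam) (hf : IsNormalized n p f) :
    DiskSummable (transformCoeff n p δ lam μ l f) := by
  have ha := linearCoeff_nonneg (p := p) hμ hlam hl
  have hb := quadCoeff_nonneg (p := p) hμ hlam hl
  set a := linearCoeff p lam μ l with ha'
  set b := quadCoeff p lam μ l with hb'
  -- For `i ≥ 1` the base lies between `1` and `(1 + a + b) i ^ 2`, so the exponent `δ` may be
  -- rounded up to a natural number.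
  refine (baseCoeff_diskSummable hn hf).mul_of_le_pow (C := (1 + a + b) ^ ⌈δ⌉₊)
    (N := 2 * ⌈δ⌉₊) fun i hi => ?_
  have hi' : (1 : ℝ) ≤ i := by exact_mod_cast hi
  rw [multiplier_eq hp hl, ← ha', ← hb', Complex.norm_real,
    Real.norm_of_nonneg (by positivity), pow_mul, ← mul_pow]
  have h1 : 1 ≤ 1 + a * i + b * (i : ℝ) ^ 2 := by
    have := mul_nonneg ha (by positivity : (0 : ℝ) ≤ i)
    have := mul_nonneg hb (by positivity : (0 : ℝ) ≤ (i : ℝ) ^ 2)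
    linarith
  have h2 : 1 + a * i + b * (i : ℝ) ^ 2 ≤ (1 + a + b) * (i : ℝ) ^ 2 := by
    nlinarith [mul_nonneg ha (mul_nonneg (by linarith : (0 : ℝ) ≤ i) (sub_nonneg.2 hi'))]
  calc (1 + a * i + b * (i : ℝ) ^ 2) ^ δ
      ≤ (1 + a * i + b * (i : ℝ) ^ 2) ^ (⌈δ⌉₊ : ℝ) :=
        Real.rpow_le_rpow_of_exponent_le h1 (Nat.le_ceil δ)
    _ = (1 + a * i + b * (i : ℝ) ^ 2) ^ ⌈δ⌉₊ := Real.rpow_natCast _ _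
    _ ≤ _ := by gcongr

theorem multiplierTransform_eq (hn : 1 ≤ n) (hp : 1 ≤ p) (hl : 0 ≤ l)
    (hs : DiskSummable (transformCoeff n p δ lam μ l f)) {z : ℂ} (hz : z ∈ unitDisk) :
    multiplierTransform n p δ lam μ l f z =
      z ^ p * powerSum (transformCoeff n p δ lam μ l f) z := by
  obtain ⟨m, rfl⟩ := Nat.exists_eq_add_of_le' hn
  -- Of the first `n` terms only the constant `1` survives, because of the gap in the expansion of
  -- `f`.
  have h0 : ∑ i ∈ Finset.range (m + 1), transformCoeff (m + 1) p δ lam μ l f i * z ^ i = 1 := by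
    rw [Finset.sum_range_succ', transformCoeff_zero hp hl, Finset.sum_eq_zero]
    · simp
    · intro i hi
      simp [transformCoeff, baseCoeff, Finset.mem_range.1 hi]
  rw [powerSum, ← (hs.summable hz).sum_add_tsum_nat_add (m + 1), h0, mul_add, mul_one,
    multiplierTransform, ← tsum_mul_left]
  congr 1
  refine tsum_congr fun j => ?_
  have e : m + 1 + p + j = p + (j + (m + 1)) := by omega
  rw [transformCoeff, baseCoeff, if_neg (by omega), if_neg (by omega), e, pow_add]
  ring

/-- The coefficients of `(J f)' z / z ^ (p - 1)` for the multiplier transform `J f`. -/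
noncomputable def derivCoeff (n p : ℕ) (δ lam μ l : ℝ) (f : ℂ → ℂ) (i : ℕ) : ℂ :=
  ((p : ℂ) + i) * transformCoeff n p δ lam μ l f i

theorem DiskSummable.const_add_natCast_mul {e : ℕ → ℂ} (he : DiskSummable e) (p : ℕ) :
    DiskSummable fun i => ((p : ℂ) + i) * e i :=
  he.mul_of_le_pow (C := p + 1) (N := 1) fun i hi => by
    have hi' : (1 : ℝ) ≤ i := by exact_mod_cast hi
    rw [← Nat.cast_add, Complex.norm_natCast]
    push_cast
    nlinarith [(Nat.cast_nonneg p : (0 : ℝ) ≤ p)]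

theorem deriv_multiplierTransform (hn : 1 ≤ n) (hp : 1 ≤ p) (hl : 0 ≤ l)
    (hs : DiskSummable (transformCoeff n p δ lam μ l f)) {z : ℂ} (hz : z ∈ unitDisk) :
    deriv (multiplierTransform n p δ lam μ l f) z =
      z ^ (p - 1) * powerSum (derivCoeff n p δ lam μ l f) z := by
  have heq : multiplierTransform n p δ lam μ l f =ᶠ[𝓝 z]
      fun y => y ^ p * powerSum (transformCoeff n p δ lam μ l f) y := by
    filter_upwards [isOpen_unitDisk.mem_nhds hz] with y hy
    exact multiplierTransform_eq hn hp hl hs hy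
  have hsum : powerSum (derivCoeff n p δ lam μ l f) z =
      p * powerSum (transformCoeff n p δ lam μ l f) z +
        z * deriv (powerSum (transformCoeff n p δ lam μ l f)) z := by
    rw [hs.mul_deriv hz, powerSum, powerSum, powerSum, ← tsum_mul_left,
      ← ((hs.summable hz).mul_left _).tsum_add (hs.natCast_mul.summable hz)]
    refine tsum_congr fun i => ?_
    rw [derivCoeff]
    ring
  have hd := (hs.differentiableAt_and_mul_deriv hz).1
  rw [heq.deriv_eq, deriv_fun_mul (by fun_prop) hd, hsum, deriv_pow_field]
  obtain ⟨q, rfl⟩ := Nat.exists_eq_add_of_le' hp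
  simp only [Nat.add_sub_cancel, pow_succ]
  ring

theorem powerSum_derivCoeff_add_one (hp : 1 ≤ p) (hl : 0 ≤ l) (hμ : 0 ≤ μ) (hlam : μ ≤ lam)
    (hs : DiskSummable (derivCoeff n p δ lam μ l f)) {z : ℂ} (hz : z ∈ unitDisk) :
    powerSum (derivCoeff n p (δ + 1) lam μ l f) z =
      powerSum (derivCoeff n p δ lam μ l f) z +
        linearCoeff p lam μ l * powerSum (fun i => (i : ℂ) * derivCoeff n p δ lam μ l f i) z +
        quadCoeff p lam μ l *
          powerSum (fun i => (i : ℂ) * ((i : ℂ) * derivCoeff n p δ lam μ l f i)) z := by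
  have s1 := (hs.natCast_mul.summable hz).mul_left (linearCoeff p lam μ l : ℂ)
  have s2 := (hs.natCast_mul.natCast_mul.summable hz).mul_left (quadCoeff p lam μ l : ℂ)
  rw [powerSum, powerSum, powerSum, powerSum, ← tsum_mul_left, ← tsum_mul_left,
    ← (hs.summable hz).tsum_add s1, ← ((hs.summable hz).add s1).tsum_add s2]
  refine tsum_congr fun i => ?_
  rw [derivCoeff, transformCoeff_add_one hp hl hμ hlam, derivCoeff]
  ring

end

/-- The quotient of a function by a power of `z` is determined on the disk by continuity. -/
theorem eqOn_of_pow_mul_eq {F G : ℂ → ℂ} {m : ℕ} (hF : ContinuousOn F unitDisk)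
    (hG : ContinuousOn G unitDisk) (h : ∀ z ∈ unitDisk, z ^ m * F z = z ^ m * G z) :
    Set.EqOn F G unitDisk := by
  have hne : ∀ z ∈ unitDisk, z ≠ 0 → F z = G z := fun z hz hz0 =>
    mul_left_cancel₀ (pow_ne_zero m hz0) (h z hz)
  intro z hz
  rcases eq_or_ne z 0 with rfl | hz0
  · have hU := isOpen_unitDisk.mem_nhds hz
    refine (((hF.continuousAt hU).eventuallyEq_nhds_iff_eventuallyEq_nhdsNE
      (hG.continuousAt hU)).1 ?_).eq_of_nhds
    filter_upwards [mem_nhdsWithin_of_mem_nhds hU, self_mem_nhdsWithin] with y hy hy0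
    exact hne y hy hy0
  · exact hne z hz hz0

end MultiplierClass

open MultiplierClass in
theorem theorem2p2 (n p : ℕ) (hn : 1 ≤ n) (hp : 1 ≤ p)
    (δ lam μ l σ A₁ A₂ B₁ B₂ : ℝ)
    (hδ : 0 ≤ δ) (hμ : 0 ≤ μ) (hlam : μ ≤ lam) (hl : 0 ≤ l)
    (hσ : 0 ≤ σ) (hσp : σ < (p : ℝ))
    (hA₂ : -1 ≤ A₂) (hA : A₂ ≤ A₁) (hAB : A₁ < B₁) (hB : B₁ ≤ B₂) (hB₂ : B₂ ≤ 1) :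
    MultiplierClass.classP n p (δ + 1) lam μ l B₁ A₁ σ ⊆
      MultiplierClass.classP n p δ lam μ l B₂ A₂ σ := by
  rintro f ⟨hf, F, hFa, hF, hsub⟩
  have hs : ∀ ε, DiskSummable (transformCoeff n p ε lam μ l f) := fun ε =>
    transformCoeff_diskSummable hn hp hl hμ hlam hf
  have hd : ∀ ε, DiskSummable (derivCoeff n p ε lam μ l f) := fun ε =>
    (hs ε).const_add_natCast_mul p
  set G := powerSum (derivCoeff n p δ lam μ l f) with hG
  set κ : ℂ := 1 / ((p : ℂ) - (σ : ℂ)) with hκ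
  have hpσ : (p : ℂ) - σ ≠ 0 := by exact_mod_cast (sub_pos.2 hσp).ne'
  have hGd : DifferentiableOn ℂ G unitDisk := (hd δ).differentiableOn
  have hGa : AnalyticOnNhd ℂ G unitDisk := hGd.analyticOnNhd isOpen_unitDisk
  -- Membership supplies only some analytic quotient `F`; it must be identified with the power
  -- series.
  have hFeq : Set.EqOn F (powerSum (derivCoeff n p (δ + 1) lam μ l f)) unitDisk :=
    eqOn_of_pow_mul_eq (m := p - 1) hFa.continuousOn (hd _).differentiableOn.continuousOn
      fun z hz => by rw [← hF z hz, deriv_multiplierTransform hn hp hl (hs _) hz]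
  refine ⟨hf, G, hGa, fun z hz => deriv_multiplierTransform hn hp hl (hs δ) hz, ?_⟩
  refine subordinate_of_norm_sub_one_lt (by linarith)
    (analyticOnNhd_const.mul (hGa.sub analyticOnNhd_const)) ?_ fun z hz =>
      norm_sub_one_lt_mono hA₂ hA hAB hB hB₂ ?_
  · rw [hG, powerSum_zero, derivCoeff, transformCoeff_zero hp hl]
    simpa using inv_mul_cancel₀ hpσ
  -- `θ` kills the constant `σ`, so normalising `G` commutes with `1 + a θ + b θ²`.
  · refine norm_sub_one_lt_of_euler (G := fun z => κ * (G z - σ))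
      (G₁ := fun z => κ * powerSum (fun i => (i : ℂ) * derivCoeff n p δ lam μ l f i) z)
      (G₂ := fun z => κ *
        powerSum (fun i => (i : ℂ) * ((i : ℂ) * derivCoeff n p δ lam μ l f i)) z)
      (linearCoeff_nonneg (p := p) hμ hlam hl) (quadCoeff_nonneg (p := p) hμ hlam hl)
      (by linarith) hAB (by linarith) ((hGd.sub_const _).const_mul _)
      ((hd δ).natCast_mul.differentiableOn.const_mul _) ?_ ?_ ?_ z hz
    · intro y hy
      rw [deriv_const_mul_field, deriv_sub_const, ← (hd δ).mul_deriv hy]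
      ring
    · intro y hy
      rw [deriv_const_mul_field, ← (hd δ).natCast_mul.mul_deriv hy]
      ring
    · intro y hy
      have h := norm_sub_one_lt_of_subordinate (by linarith) hAB (by linarith) hsub y hy
      simp only [hFeq hy, powerSum_derivCoeff_add_one hp hl hμ hlam (hd δ) hy] at h
      convert h using 3 <;> ring
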